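/- Let $d,M\ge 1$, $\mathcal X\subseteq\mathbb R^d$, and let $(X^*,\epsilon^*)$ be a random vector with values in $\mathcal X\times[0,1/2)^M$ and with a density $p_0(x,\epsilon)$ (for instance $\epsilon^*$ uniform and independent of $X^*$) whose differential entropy $H(p_0)=-\int p_0\log p_0$ is finite ($p_0\log p_0$ integrable). At each time $k=0,1,\dots$ a joint policy chooses, as a function of the earlier responses $\mathbf Y_1,\dots,\mathbf Y_k$, a batch $\mathbf A_k=(A_k^{(1)},\dots,A_k^{(M)})$ of query regions, where $A_k^{(m)}$ is a union of at most $J_k^{(m)}$ half-open rectangles contained in $\mathcal X$ (such batches are called admissible at time $k$). The $M$ players then give the responses $\mathbf Y_{k+1}\in\{0,1\}^M$ with $$\mathbb P(\mathbf Y_{k+1}=\mathbf y\mid X^*,\epsilon^*,\mathcal F_k)=\prod_{m=1}^M f_{I(X^*\in A_k^{(m)})}(y^{(m)}\mid\epsilon^*_m),\qquad f_j(y\mid e)=\begin{cases}1-e,&y=j,\\ e,&y\ne j,\end{cases}$$ where $\mathcal F_k=\sigma(\mathbf Y_1,\dots,\mathbf Y_k)$. Let $P_k$ be the conditional law of $(X^*,\epsilon^*)$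 given $\mathcal F_k$, let $g_i(\mathbf y\mid\epsilon)=\prod_m f_{i_m}(y^{(m)}\mid\epsilon_m)$ for $i\in\{0,1\}^M$, and, with $A^1=A$, $A^0=A^c$ and $H$ the Shannon entropy of a probability mass function, let $$G_k^*=\sup_{\mathbf A}\Big\{H\Big(\sum_{i}\int g_i(\cdot\mid\epsilon)\,P_k\big(\textstyle\bigcap_m (A^{(m)})^{i_m},d\epsilon\big)\Big)-\sum_{i}\int H\big(g_i(\cdot\mid\epsilon)\big)\,P_k\big(\textstyle\bigcap_m (A^{(m)})^{i_m},d\epsilon\big)\Big\},$$ the supremum being over the batches admissible at time $k$. All logarithms are natural. Then, for every such policy, in particular for an optimal one (one that attains $G_k^*$ at each time), and for every $n$, $$\frac{K}{2\pi e}\,d\,\exp\Big(-\frac{2n\bar C_n}{d}\Big)\le\mathbb E\big[\|X_n-X^*\|_2^2\big]+\mathbb E\big[\|\epsilon_n-\epsilon^*\|_2^2\big],$$ where $K=\exp(2H(p_0)/d)$, $X_n=\mathbb E[X^*\mid\mathcal F_n]$, $\epsilon_n=\mathbb E[\epsilon^*\mid\mathcal F_n]$, and $\bar C_n=\frac1n\sum_{k=0}^{n-1}\mathbb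 E[G_k^*]$ is the expected optimal entropy loss per iteration. (If $\mathbb E\|X^*\|_2^2=\infty$, the right-hand side is $+\infty$.) -/

import Mathlib

open MeasureTheory ProbabilityTheory

noncomputable section

namespace TwentyQuestions

/-- The joint parameter space of `(X*, ε*)`: target location in `ℝ^d`, error probabilities in
`ℝ^M`, each with its Euclidean norm. -/
abbrev Param (d M : ℕ) : Type := EuclideanSpace ℝ (Fin d) × EuclideanSpace ℝ (Fin M)

/-- One batch of responses `y = (y⁽¹⁾, …, y⁽ᴹ⁾)` of the `M` players. -/
abbrev Response (M : ℕ) : Type := Fin M → Bool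

/-- The responses received before the batch of queries number `k` is designed. -/
abbrev History (M k : ℕ) : Type := Fin k → Response M

/-- A batch of queries `A = (A⁽¹⁾, …, A⁽ᴹ⁾)`. -/
abbrev Query (d M : ℕ) : Type := Fin M → Set (EuclideanSpace ℝ (Fin d))

/-- A joint query policy: the batch asked at time `k` is a function of the responses so far. -/
abbrev Policy (d M : ℕ) : Type := ∀ k : ℕ, History M k → Query d M

/-- The half-open rectangle `[a₁, b₁) × ⋯ × [a_d, b_d)`. -/
def rectangle {d : ℕ} (a b : EuclideanSpace ℝ (Fin d)) : Set (EuclideanSpace ℝ (Fin d)) :=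
  {x | ∀ l, a l ≤ x l ∧ x l < b l}

/-- Query regularity: the query to player `m` is a union of at most `J m` half-open rectangles
contained in `𝒳` (a rectangle with `a l = b l` for some `l` is empty). -/
def Admissible {d M : ℕ} (𝒳 : Set (EuclideanSpace ℝ (Fin d))) (J : Fin M → ℕ)
    (A : Query d M) : Prop :=
  ∀ m, ∃ a b : Fin (J m) → EuclideanSpace ℝ (Fin d),
    (∀ j l, a j l ≤ b j l) ∧ (∀ j, rectangle (a j) (b j) ⊆ 𝒳) ∧
    A m = ⋃ j, rectangle (a j) (b j)

/-- The binary symmetric channel `f_j(y | e)` with crossover probability `e` and input `j`. -/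
def bsc (e : ℝ) (j y : Bool) : ℝ := if y = j then 1 - e else e

/-- `g_i(y | ε) = ∏ₘ f_{iₘ}(y⁽ᵐ⁾ | εₘ)`: conditionally independent players. -/
def channel {M : ℕ} (i y : Response M) (ε : EuclideanSpace ℝ (Fin M)) : ℝ :=
  ∏ m, bsc (ε m) (i m) (y m)

open Classical in
/-- The true answers `(1(x ∈ A⁽¹⁾), …, 1(x ∈ A⁽ᴹ⁾))` to a batch of queries. -/
def truth {d M : ℕ} (A : Query d M) (x : EuclideanSpace ℝ (Fin d)) : Response M :=
  fun m => decide (x ∈ A m)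

/-- The cell `⋂ₘ (A⁽ᵐ⁾)^{iₘ}`, where `A¹ = A` and `A⁰ = Aᶜ`. -/
def cell {d M : ℕ} (A : Query d M) (i : Response M) : Set (EuclideanSpace ℝ (Fin d)) :=
  ⋂ m, if i m = true then A m else (A m)ᶜ

/-- Shannon entropy (in nats) of a probability mass function on the responses. -/
def pmfEntropy {M : ℕ} (f : Response M → ℝ) : ℝ := ∑ y, Real.negMulLog (f y)

/-- Differential entropy (in nats) of a density on the parameter space. -/
def diffEntropy {d M : ℕ} (p : Param d M → ℝ) : ℝ := ∫ z, Real.negMulLog (p z)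

/-- The information gain of the batch `A` when `(X*, ε*)` has the (posterior) law `P`:
`H(∑ᵢ ∫ g_i(· | ε) P(cell_i, dε)) - ∑ᵢ ∫ H(g_i(· | ε)) P(cell_i, dε)`. -/
def gain {d M : ℕ} (P : Measure (Param d M)) (A : Query d M) : ℝ :=
  pmfEntropy (fun y => ∑ i : Response M, ∫ z in {z | z.1 ∈ cell A i}, channel i y z.2 ∂P)
    - ∑ i : Response M, ∫ z in {z | z.1 ∈ cell A i}, pmfEntropy (fun y => channel i y z.2) ∂P

/-- The optimal gain: supremum of the gain over the admissible batches of queries. -/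
def optimalGain {d M : ℕ} (𝒳 : Set (EuclideanSpace ℝ (Fin d))) (J : Fin M → ℕ)
    (P : Measure (Param d M)) : ℝ :=
  sSup (gain P '' {A | Admissible 𝒳 J A})

section Game

variable {Ω : Type*} [MeasurableSpace Ω] {d M : ℕ}

/-- The history at time `k`; `Y j` is the batch of responses to the batch of queries number `j`. -/
def hist (Y : ℕ → Ω → Response M) (k : ℕ) (ω : Ω) : History M k := fun j => Y j ω

/-- The information `ℱ_k` available at time `k`. As queries are functions of past responses, it is
generated by the responses. -/
abbrev info (Y : ℕ → Ω → Response M) (k : ℕ) : MeasurableSpace Ω :=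
  MeasurableSpace.comap (hist Y k) inferInstance

/-- The posterior law of `(X*, ε*)` at time `k` after the history `h`. -/
def posterior (μ : Measure Ω) (X : Ω → EuclideanSpace ℝ (Fin d))
    (ε : Ω → EuclideanSpace ℝ (Fin M)) (Y : ℕ → Ω → Response M) (k : ℕ) (h : History M k) :
    Measure (Param d M) :=
  (μ[|hist Y k ⁻¹' {h}]).map (fun ω => (X ω, ε ω))

/-- The responses are conditionally independent binary symmetric channels: given `X*`, `ε*` and
`ℱ_k`, the probability that the batch `Y k` equals `y` is `∏ₘ f_{1(X* ∈ A⁽ᵐ⁾)}(y⁽ᵐ⁾ | ε*ₘ)`,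
with `A` the batch that the policy asks at time `k`. -/
def FollowsModel (μ : Measure Ω) (X : Ω → EuclideanSpace ℝ (Fin d))
    (ε : Ω → EuclideanSpace ℝ (Fin M)) (Y : ℕ → Ω → Response M) (ζ : Policy d M) : Prop :=
  ∀ (k : ℕ) (y : Response M),
    μ[(Y k ⁻¹' {y}).indicator (fun _ => (1 : ℝ)) |
        MeasurableSpace.comap (fun ω => ((X ω, ε ω), hist Y k ω)) inferInstance]
      =ᵐ[μ] fun ω => channel (truth (ζ k (hist Y k ω)) (X ω)) y (ε ω)

/-- `C̄_n = (1/n) ∑_{k<n} 𝔼[G_k*]`: the expected optimal entropy loss per iteration, `G_k*` being the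
optimal gain at the (random) posterior at time `k`. -/
def averageGain (μ : Measure Ω) (X : Ω → EuclideanSpace ℝ (Fin d))
    (ε : Ω → EuclideanSpace ℝ (Fin M)) (Y : ℕ → Ω → Response M)
    (𝒳 : Set (EuclideanSpace ℝ (Fin d))) (J : ℕ → Fin M → ℕ) (n : ℕ) : ℝ :=
  (1 / (n : ℝ)) * ∑ k ∈ Finset.range n,
    ∫ ω, optimalGain 𝒳 (J k) (posterior μ X ε Y k (hist Y k ω)) ∂μ

end Game

end TwentyQuestions

end

open TwentyQuestions

/-! The bound is an information inequality. For a history `h` let `ν_h` be the law of `(X*, ε*)` on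
the event that `h` occurs. It has density `p₀ * L_h`, with `L_h` the likelihood of `h`, and mass
`m_h`, the probability of `h`. Compare it by Gibbs' inequality with a Gaussian density in `x` of
covariance `s • I`, centred at an estimate `a h`, times the indicator of `[0, 1/2)^M` in `ε`. This
product has mass at most one because the box has volume at most one.

Summing over the finitely many histories gives `H(p₀) - I ≤ (d/2) log(2πs) + D/(2s)`, where `D =
𝔼‖X* - a‖²` and `I = H(history) + 𝔼[log L]` is a mutual information (`diffEntropy_le`). By the chain
rule (`mul_gain_posterior`, telescoped in `sum_integral_gain`), `I` is the sum of the expected gains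
of the batches asked, hence at most `∑ 𝔼[G_k*] = n C̄_n`. A suitable `s` then turns the inequality
into `d * s ≤ D`, and `d * s` is the claimed bound.

The location error alone satisfies the bound. Any function of the history may serve as `a`, so no
property of the conditional mean is needed beyond its measurability. Working with the unnormalised
laws `ν_h` avoids dividing by the probabilities of null histories; the price is the term `m_h log
m_h`, which sums to minus the entropy of the history. -/

namespace TwentyQuestions

/-! ### Gibbs' inequality for unnormalised laws. -/

section Gibbs

/-- Gibbs' inequality for a finite measure `ν` of density `f` and a sub-probability density `q`. -/
theorem integral_log_add_mul_log_le_integral_log {α : Type*} [MeasurableSpace α]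
    {ρ ν : Measure α} [IsFiniteMeasure ν] {f q : α → ℝ}
    (hf : Measurable f) (hq : Measurable q) (hν : ν = ρ.withDensity fun z => ENNReal.ofReal (f z))
    (hq_mass : ∫⁻ z, ENNReal.ofReal (q z) ∂ρ ≤ 1) (hq_pos : ∀ᵐ z ∂ν, 0 < q z)
    (hlogf : Integrable (fun z => Real.log (f z)) ν)
    (hlogq : Integrable (fun z => Real.log (q z)) ν) :
    ∫ z, Real.log (q z) ∂ν + ν.real Set.univ * Real.log (ν.real Set.univ)
      ≤ ∫ z, Real.log (f z) ∂ν := by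
  set m := ν.real Set.univ with hm
  rcases eq_or_ne ν 0 with h0 | h0
  · simp [hm, h0]
  have hm_pos : 0 < m := by
    rw [hm, measureReal_def]
    exact ENNReal.toReal_pos (by simpa using h0) (measure_ne_top _ _)
  have hf_pos : ∀ᵐ z ∂ν, 0 < f z := by
    rw [hν, ae_withDensity_iff hf.ennreal_ofReal]
    refine ae_of_all _ fun z hz => ?_
    simpa using hz
  -- Only the region `f > 0` carries `ν`-mass, and there the factor `f` cancels, leaving an integral
  -- of `q`.
  have hmass : ∫⁻ z, ENNReal.ofReal (q z / f z) ∂ν ≤ 1 := by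
    rw [hν, lintegral_withDensity_eq_lintegral_mul _ hf.ennreal_ofReal
      (by fun_prop)]
    refine (lintegral_mono fun z => ?_).trans hq_mass
    simp only [Pi.mul_apply]
    rcases le_or_gt (f z) 0 with h | h
    · simp [ENNReal.ofReal_of_nonpos h]
    · rw [← ENNReal.ofReal_mul h.le, mul_div_cancel₀ _ h.ne']
  have hnn : 0 ≤ᵐ[ν] fun z => q z / f z := by
    filter_upwards [hf_pos, hq_pos] with z h1 h2 using (div_pos h2 h1).le
  have hint : Integrable (fun z => q z / f z) ν := by
    refine ⟨(hq.div hf).aestronglyMeasurable, ?_⟩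
    rw [hasFiniteIntegral_iff_ofReal hnn]
    exact hmass.trans_lt ENNReal.one_lt_top
  have hint_le : ∫ z, q z / f z ∂ν ≤ 1 := by
    rw [integral_eq_lintegral_of_nonneg_ae hnn (hq.div hf).aestronglyMeasurable]
    exact ENNReal.toReal_le_of_le_ofReal zero_le_one (by simpa using hmass)
  -- Apply `log t ≤ t - 1` to `t = m * q / f`: with the factor `m`, the integral of `t - 1` against
  -- `ν` is at most `m * 1 - m = 0`.
  have key : ∫ z, (Real.log (q z) + Real.log m) ∂ν
      ≤ ∫ z, (Real.log (f z) + (m * (q z / f z) - 1)) ∂ν := by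
    refine integral_mono_ae (hlogq.add (integrable_const _))
      (hlogf.add ((hint.const_mul m).sub (integrable_const _))) ?_
    filter_upwards [hf_pos, hq_pos] with z h1 h2
    have h3 := Real.log_le_sub_one_of_pos (mul_pos hm_pos (div_pos h2 h1))
    rw [Real.log_mul hm_pos.ne' (div_pos h2 h1).ne', Real.log_div h2.ne' h1.ne'] at h3
    linarith
  rw [integral_add hlogq (integrable_const _),
    integral_add hlogf (by simpa using! (hint.const_mul m).sub (integrable_const (1 : ℝ))),
    integral_sub (hint.const_mul m) (integrable_const _), integral_const_mul] at key
  simp only [integral_const, smul_eq_mul, mul_one] at key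
  rw [← hm] at key
  nlinarith

end Gibbs

/-! ### The reference density: a Gaussian times the indicator of the error box. -/

section ReferenceDensity

variable {d M : ℕ}

/-- The range `[0, 1/2)^M` of the error probabilities. -/
def errorBox (M : ℕ) : Set (EuclideanSpace ℝ (Fin M)) := {e | ∀ m, e m ∈ Set.Ico (0 : ℝ) (1 / 2)}

theorem measurableSet_errorBox : MeasurableSet (errorBox M) := by
  have : errorBox M = ⋂ m, (fun e : EuclideanSpace ℝ (Fin M) => e m) ⁻¹' Set.Ico (0 : ℝ) (1 / 2) := by
    ext; simp [errorBox]
  rw [this]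
  exact MeasurableSet.iInter fun m => (by fun_prop : Measurable _) measurableSet_Ico

theorem volume_errorBox_le_one : volume (errorBox M) ≤ 1 := by
  rw [← (PiLp.volume_preserving_toLp (Fin M)).measure_preimage
    measurableSet_errorBox.nullMeasurableSet]
  have : (@WithLp.toLp 2 (Fin M → ℝ)) ⁻¹' errorBox M
      = Set.univ.pi fun _ => Set.Ico (0 : ℝ) (1 / 2) := by
    ext; simp [errorBox]
  rw [this, volume_pi_pi]
  refine Finset.prod_le_one' fun i _ => ?_
  rw [Real.volume_Ico]
  exact ENNReal.ofReal_le_one.2 (by norm_num)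

/-- The product of the Gaussian density of mean `a` and covariance `s • I` with the indicator of
the range of the error probabilities. -/
noncomputable def gaussianBox (a : EuclideanSpace ℝ (Fin d)) (s : ℝ) (z : Param d M) : ℝ :=
  (errorBox M).indicator
    (fun _ => Real.exp (-(d / 2 * Real.log (2 * Real.pi * s)) - ‖z.1 - a‖ ^ 2 / (2 * s))) z.2

theorem measurable_gaussianBox (a : EuclideanSpace ℝ (Fin d)) (s : ℝ) :
    Measurable (gaussianBox (M := M) a s) := by
  have : gaussianBox (M := M) a s = ((Prod.snd : Param d M → _) ⁻¹' errorBox M).indicator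
      fun z => Real.exp (-(d / 2 * Real.log (2 * Real.pi * s)) - ‖z.1 - a‖ ^ 2 / (2 * s)) := by
    rfl
  rw [this]
  exact Measurable.indicator (by fun_prop) (measurable_snd measurableSet_errorBox)

/-- The Gaussian factor integrates to one and the box has volume at most one. A sub-probability is
all that Gibbs' inequality needs, so the box is left unnormalised. -/
theorem lintegral_gaussianBox_le_one (a : EuclideanSpace ℝ (Fin d)) {s : ℝ} (hs : 0 < s) :
    ∫⁻ z, ENNReal.ofReal (gaussianBox (M := M) a s z) ≤ 1 := by
  set G : EuclideanSpace ℝ (Fin d) → ℝ := fun x =>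
    Real.exp (-(d / 2 * Real.log (2 * Real.pi * s)) - ‖x - a‖ ^ 2 / (2 * s)) with hG
  have hGeq : G = fun x => Real.exp (-(d / 2 * Real.log (2 * Real.pi * s))) *
      (fun v => Real.exp (-(1 / (2 * s)) * ‖v‖ ^ 2)) (x - a) := by
    ext x
    simp only [hG]
    rw [← Real.exp_add]
    congr 1
    ring
  have hb : 0 < 1 / (2 * s) := by positivity
  have hval := GaussianFourier.integral_rexp_neg_mul_sq_norm
    (V := EuclideanSpace ℝ (Fin d)) hb
  have hGval : ∫ x, G x = 1 := by
    rw [hGeq, integral_const_mul,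
      integral_sub_right_eq_self (fun v : EuclideanSpace ℝ (Fin d) =>
        Real.exp (-(1 / (2 * s)) * ‖v‖ ^ 2)) a, hval]
    have : Real.pi / (1 / (2 * s)) = 2 * Real.pi * s := by field_simp
    rw [this, Real.rpow_def_of_pos (by positivity), ← Real.exp_add, finrank_euclideanSpace_fin]
    rw [Real.exp_eq_one_iff]
    ring
  -- A non-integrable function has Bochner integral `0`, so the value `1` already forces
  -- integrability.
  have hGint : Integrable G := by
    by_contra h
    rw [integral_undef h] at hGval
    exact zero_ne_one hGval
  have hGlint : ∫⁻ x, ENNReal.ofReal (G x) = 1 := by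
    rw [← ofReal_integral_eq_lintegral_ofReal hGint (ae_of_all _ fun x => (Real.exp_pos _).le),
      hGval, ENNReal.ofReal_one]
  have hprod : ∀ z : Param d M, ENNReal.ofReal (gaussianBox a s z)
      = ENNReal.ofReal (G z.1) * (errorBox M).indicator (fun _ => 1) z.2 := by
    intro z
    by_cases h : z.2 ∈ errorBox M <;> simp [gaussianBox, h, hG]
  simp_rw [hprod]
  rw [Measure.volume_eq_prod, lintegral_prod_mul
    (f := fun x => ENNReal.ofReal (G x)) (g := (errorBox M).indicator fun _ => 1)
    (hGint.aestronglyMeasurable.aemeasurable.ennreal_ofReal)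
    ((measurable_const.indicator measurableSet_errorBox).aemeasurable), hGlint, one_mul,
    lintegral_indicator measurableSet_errorBox, setLIntegral_one]
  exact volume_errorBox_le_one

theorem gaussianBox_pos (a : EuclideanSpace ℝ (Fin d)) (s : ℝ) {z : Param d M}
    (hz : z.2 ∈ errorBox M) : 0 < gaussianBox a s z := by
  simp [gaussianBox, hz, Real.exp_pos]

theorem log_gaussianBox (a : EuclideanSpace ℝ (Fin d)) (s : ℝ) {z : Param d M}
    (hz : z.2 ∈ errorBox M) : Real.log (gaussianBox a s z)
      = -(d / 2 * Real.log (2 * Real.pi * s)) - ‖z.1 - a‖ ^ 2 / (2 * s) := by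
  simp [gaussianBox, hz]

end ReferenceDensity

/-! ### The channel, the likelihood of one batch of responses, and bounds on the gain. -/

section Channel

variable {d M : ℕ}

theorem channel_nonneg (i y : Response M) {e : EuclideanSpace ℝ (Fin M)} (he : e ∈ errorBox M) :
    0 ≤ channel i y e := by
  refine Finset.prod_nonneg fun m _ => ?_
  have := he m
  simp only [Set.mem_Ico] at this
  unfold bsc
  split_ifs <;> linarith

theorem sum_channel (i : Response M) (e : EuclideanSpace ℝ (Fin M)) :
    ∑ y, channel i y e = 1 := by
  have h := Finset.prod_univ_sum (fun _ : Fin M => (Finset.univ : Finset Bool))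
    (fun m b => bsc (e m) (i m) b)
  rw [Fintype.piFinset_univ] at h
  unfold channel
  rw [← h]
  refine Finset.prod_eq_one fun m _ => ?_
  cases i m <;> simp [bsc]

theorem channel_le_one (i y : Response M) {e : EuclideanSpace ℝ (Fin M)} (he : e ∈ errorBox M) :
    channel i y e ≤ 1 := by
  rw [← sum_channel i e]
  exact Finset.single_le_sum (fun y _ => channel_nonneg i y he) (Finset.mem_univ y)

theorem measurable_channel (i y : Response M) : Measurable (channel i y) := by
  refine Finset.measurable_prod _ fun m _ => ?_
  unfold bsc
  split_ifs <;> fun_prop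

theorem measurableSet_rectangle (a b : EuclideanSpace ℝ (Fin d)) :
    MeasurableSet (rectangle a b) := by
  have : rectangle a b
      = ⋂ l, (fun x : EuclideanSpace ℝ (Fin d) => x l) ⁻¹' Set.Ico (a l) (b l) := by
    ext; simp [rectangle]
  rw [this]
  exact MeasurableSet.iInter fun m => (by fun_prop : Measurable _) measurableSet_Ico

theorem Admissible.measurableSet {𝒳 : Set (EuclideanSpace ℝ (Fin d))} {J : Fin M → ℕ}
    {A : Query d M} (hA : Admissible 𝒳 J A) (m : Fin M) : MeasurableSet (A m) := by
  obtain ⟨a, b, -, -, h⟩ := hA m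
  rw [h]
  exact MeasurableSet.iUnion fun j => measurableSet_rectangle _ _

theorem mem_cell_iff {A : Query d M} {i : Response M} {x : EuclideanSpace ℝ (Fin d)} :
    x ∈ cell A i ↔ truth A x = i := by
  simp only [cell, Set.mem_iInter, funext_iff, truth]
  refine forall_congr' fun m => ?_
  cases h : i m <;> simp

theorem measurableSet_cell {A : Query d M} (hA : ∀ m, MeasurableSet (A m)) (i : Response M) :
    MeasurableSet (cell A i) := by
  refine MeasurableSet.iInter fun m => ?_
  split_ifs
  exacts [hA m, (hA m).compl]

theorem measurable_truth {A : Query d M} (hA : ∀ m, MeasurableSet (A m)) :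
    Measurable (truth A) := by
  refine measurable_to_countable' fun i => ?_
  have : truth A ⁻¹' {i} = cell A i := by ext x; simp [mem_cell_iff]
  rw [this]
  exact measurableSet_cell hA i

/-- The likelihood of the response `y` to the batch `A`, as a function of the parameter. -/
noncomputable def queryLik (A : Query d M) (y : Response M) (z : Param d M) : ℝ :=
  channel (truth A z.1) y z.2

theorem measurable_queryLik {A : Query d M} (hA : ∀ m, MeasurableSet (A m)) (y : Response M) :
    Measurable (queryLik A y) := by
  have h : Measurable fun p : Response M × EuclideanSpace ℝ (Fin M) => channel p.1 y p.2 :=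
    measurable_from_prod_countable_right fun i => measurable_channel i y
  exact h.comp (((measurable_truth hA).comp measurable_fst).prodMk measurable_snd)

theorem queryLik_nonneg (A : Query d M) (y : Response M) {z : Param d M}
    (hz : z.2 ∈ errorBox M) : 0 ≤ queryLik A y z :=
  channel_nonneg _ y hz

theorem queryLik_le_one (A : Query d M) (y : Response M) {z : Param d M}
    (hz : z.2 ∈ errorBox M) : queryLik A y z ≤ 1 :=
  channel_le_one _ y hz

/-- The cells partition the space of locations, and `truth A x` is the index of the one containing
`x`. -/
theorem sum_setIntegral_cell {P : Measure (Param d M)} {A : Query d M}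
    (hA : ∀ m, MeasurableSet (A m)) {F : Response M → Param d M → ℝ}
    (hF : ∀ i, Integrable (F i) P) :
    ∑ i, ∫ z in {z | z.1 ∈ cell A i}, F i z ∂P = ∫ z, F (truth A z.1) z ∂P := by
  have hS : ∀ i, MeasurableSet {z : Param d M | z.1 ∈ cell A i} := fun i =>
    measurable_fst (measurableSet_cell hA i)
  simp_rw [← integral_indicator (hS _)]
  rw [← integral_finsetSum _ fun i _ => (hF i).indicator (hS i)]
  congr 1 with z
  rw [Finset.sum_eq_single (truth A z.1)]
  · exact Set.indicator_of_mem (s := {z : Param d M | z.1 ∈ cell A (truth A z.1)})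
      (mem_cell_iff.2 rfl) _
  · intro i _ hi
    exact Set.indicator_of_notMem (s := {z : Param d M | z.1 ∈ cell A i})
      (fun h => hi (mem_cell_iff.1 h).symm) _
  · simp

theorem integrable_of_mem_unitInterval {α : Type*} [MeasurableSpace α] {P : Measure α}
    [IsFiniteMeasure P] {f : α → ℝ} (hf : Measurable f) (h : ∀ᵐ z ∂P, 0 ≤ f z ∧ f z ≤ 1) :
    Integrable f P := by
  refine Integrable.of_bound hf.aestronglyMeasurable 1 ?_
  filter_upwards [h] with z hz
  rw [Real.norm_of_nonneg hz.1]
  exact hz.2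

theorem negMulLog_mem_unitInterval {x : ℝ} (h0 : 0 ≤ x) (h1 : x ≤ 1) :
    0 ≤ Real.negMulLog x ∧ Real.negMulLog x ≤ 1 :=
  ⟨Real.negMulLog_nonneg h0 h1, (Real.negMulLog_le_one_sub_self h0).trans (by linarith)⟩

variable {P : Measure (Param d M)} [IsFiniteMeasure P]

theorem integrable_channel (hP : ∀ᵐ z ∂P, z.2 ∈ errorBox M) (i y : Response M) :
    Integrable (fun z : Param d M => channel i y z.2) P :=
  integrable_of_mem_unitInterval ((measurable_channel i y).comp measurable_snd)
    (hP.mono fun _ hz => ⟨channel_nonneg i y hz, channel_le_one i y hz⟩)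

theorem integrable_negMulLog_channel (hP : ∀ᵐ z ∂P, z.2 ∈ errorBox M) (i y : Response M) :
    Integrable (fun z : Param d M => Real.negMulLog (channel i y z.2)) P :=
  integrable_of_mem_unitInterval
    (Real.continuous_negMulLog.measurable.comp ((measurable_channel i y).comp measurable_snd))
    (hP.mono fun _ hz => negMulLog_mem_unitInterval (channel_nonneg i y hz) (channel_le_one i y hz))

theorem integrable_negMulLog_queryLik (hP : ∀ᵐ z ∂P, z.2 ∈ errorBox M) {A : Query d M}
    (hA : ∀ m, MeasurableSet (A m)) (y : Response M) :
    Integrable (fun z => Real.negMulLog (queryLik A y z)) P :=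
  integrable_of_mem_unitInterval
    (Real.continuous_negMulLog.measurable.comp (measurable_queryLik hA y))
    (hP.mono fun _ hz => negMulLog_mem_unitInterval (queryLik_nonneg A y hz) (queryLik_le_one A y hz))

/-- On cell `i` the function `queryLik A y` is `g_i(y | ε)`, so the sums over cells merge into
single integrals. The gain becomes, response by response, the gap between `negMulLog` of the mean
likelihood and the mean of its `negMulLog`. -/
theorem gain_eq (hP : ∀ᵐ z ∂P, z.2 ∈ errorBox M) {A : Query d M}
    (hA : ∀ m, MeasurableSet (A m)) :
    gain P A = ∑ y, Real.negMulLog (∫ z, queryLik A y z ∂P)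
      - ∑ y, ∫ z, Real.negMulLog (queryLik A y z) ∂P := by
  unfold gain pmfEntropy
  congr 1
  · refine Finset.sum_congr rfl fun y _ => ?_
    beta_reduce
    rw [sum_setIntegral_cell hA (F := fun i z => channel i y z.2)
      fun i => integrable_channel hP i y]
    rfl
  · rw [sum_setIntegral_cell hA (F := fun i z => ∑ y, Real.negMulLog (channel i y z.2))
      fun i => integrable_finsetSum _ fun y _ => integrable_negMulLog_channel hP i y,
      integral_finsetSum]
    · rfl
    · exact fun y _ => integrable_negMulLog_queryLik hP hA y

/-- Each of the output entropy terms is at most `1`, and the subtracted part is nonnegative. The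
bound is crude; it serves only to make the supremum in `optimalGain` a genuine one, as `sSup` of an
unbounded set of reals is `0`. -/
theorem gain_le_card (hP : ∀ᵐ z ∂P, z.2 ∈ errorBox M) {A : Query d M}
    (hA : ∀ m, MeasurableSet (A m)) : gain P A ≤ Fintype.card (Response M) := by
  rw [gain_eq hP hA]
  have h1 : ∑ y, Real.negMulLog (∫ z, queryLik A y z ∂P) ≤ ∑ _y : Response M, (1 : ℝ) := by
    refine Finset.sum_le_sum fun y _ => ?_
    have h0 : 0 ≤ ∫ z, queryLik A y z ∂P :=
      integral_nonneg_of_ae (hP.mono fun _ hz => queryLik_nonneg A y hz)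
    linarith [Real.negMulLog_le_one_sub_self h0]
  have h2 : 0 ≤ ∑ y, ∫ z, Real.negMulLog (queryLik A y z) ∂P :=
    Finset.sum_nonneg fun y _ => integral_nonneg_of_ae <| hP.mono fun _ hz =>
      Real.negMulLog_nonneg (queryLik_nonneg A y hz) (queryLik_le_one A y hz)
  simp only [Finset.sum_const, Finset.card_univ, nsmul_eq_mul, mul_one] at h1
  linarith

theorem gain_le_optimalGain (hP : ∀ᵐ z ∂P, z.2 ∈ errorBox M)
    {𝒳 : Set (EuclideanSpace ℝ (Fin d))} {J : Fin M → ℕ} {A : Query d M}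
    (hA : Admissible 𝒳 J A) : gain P A ≤ optimalGain 𝒳 J P := by
  refine le_csSup ⟨Fintype.card (Response M), ?_⟩ ⟨A, hA, rfl⟩
  rintro _ ⟨B, hB, rfl⟩
  exact gain_le_card hP (Admissible.measurableSet hB)

end Channel

/-! ### Bayes' rule for the laws of the parameter along the histories. -/

section Posterior

variable {M : ℕ}

theorem hist_succ_eq_snoc_iff {Ω : Type*} {Y : ℕ → Ω → Response M} {k : ℕ}
    {h : History M k} {y : Response M} {ω : Ω} :
    hist Y (k + 1) ω = (Fin.snoc h y : History M (k + 1)) ↔ hist Y k ω = h ∧ Y k ω = y := by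
  constructor
  · intro hw
    refine ⟨?_, ?_⟩
    · ext1 j
      have := congrFun hw j.castSucc
      simpa [hist] using this
    · have := congrFun hw (Fin.last k)
      simpa [hist] using this
  · rintro ⟨rfl, rfl⟩
    ext1 j
    refine Fin.lastCases ?_ (fun j => ?_) j <;> simp [hist]

theorem sum_history_succ {k : ℕ} (F : History M (k + 1) → ℝ) :
    ∑ w, F w = ∑ h : History M k, ∑ y : Response M, F (Fin.snoc h y : History M (k + 1)) := by
  rw [← (Fin.snocEquiv fun _ : Fin (k + 1) => Response M).sum_comp, Fintype.sum_prod_type,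
    Finset.sum_comm]
  rfl

variable {Ω : Type*} [MeasurableSpace Ω] {d : ℕ} {μ : Measure Ω}
  {X : Ω → EuclideanSpace ℝ (Fin d)} {ε : Ω → EuclideanSpace ℝ (Fin M)}
  {Y : ℕ → Ω → Response M} {ζ : Policy d M}

theorem measurable_hist (hY : ∀ k, Measurable (Y k)) (k : ℕ) : Measurable (hist Y k) :=
  measurable_pi_lambda _ fun j => hY j

/-- The law of `(X*, ε*)` on the event that the history at time `k` is `h`. -/
noncomputable def jointLaw (μ : Measure Ω) (X : Ω → EuclideanSpace ℝ (Fin d))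
    (ε : Ω → EuclideanSpace ℝ (Fin M)) (Y : ℕ → Ω → Response M) (k : ℕ) (h : History M k) :
    Measure (Param d M) :=
  (μ.restrict (hist Y k ⁻¹' {h})).map fun ω => (X ω, ε ω)

instance [IsFiniteMeasure μ] (k : ℕ) (h : History M k) : IsFiniteMeasure (jointLaw μ X ε Y k h) := by
  unfold jointLaw; infer_instance

theorem posterior_eq (k : ℕ) (h : History M k) :
    posterior μ X ε Y k h = (μ (hist Y k ⁻¹' {h}))⁻¹ • jointLaw μ X ε Y k h := by
  unfold posterior jointLaw ProbabilityTheory.cond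
  rw [Measure.map_smul]

theorem jointLaw_real_univ (hX : Measurable X) (hε : Measurable ε) (k : ℕ) (h : History M k) :
    (jointLaw μ X ε Y k h).real Set.univ = μ.real (hist Y k ⁻¹' {h}) := by
  simp [jointLaw, measureReal_def, Measure.map_apply (hX.prodMk hε)]

theorem jointLaw_zero (h : History M 0) :
    jointLaw μ X ε Y 0 h = μ.map fun ω => (X ω, ε ω) := by
  have : hist Y 0 ⁻¹' {h} = Set.univ := by
    ext ω; simp [Subsingleton.elim (hist Y 0 ω) h]
  rw [jointLaw, this, Measure.restrict_univ]

theorem ae_jointLaw_mem_errorBox (hX : Measurable X) (hε : Measurable ε)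
    (hbox : ∀ᵐ ω ∂μ, ε ω ∈ errorBox M) (k : ℕ) (h : History M k) :
    ∀ᵐ z ∂jointLaw μ X ε Y k h, z.2 ∈ errorBox M := by
  unfold jointLaw
  rw [ae_map_iff (hX.prodMk hε).aemeasurable (measurable_snd measurableSet_errorBox)]
  exact ae_restrict_of_ae hbox

theorem integrable_queryLik_mul (hX : Measurable X) (hε : Measurable ε)
    (hζ : ∀ k h m, MeasurableSet (ζ k h m)) (hbox : ∀ᵐ ω ∂μ, ε ω ∈ errorBox M)
    {k : ℕ} {h : History M k} (y : Response M) {φ : Param d M → ℝ}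
    (hφ : Integrable φ (jointLaw μ X ε Y k h)) :
    Integrable (fun z => queryLik (ζ k h) y z * φ z) (jointLaw μ X ε Y k h) := by
  refine hφ.bdd_mul (c := 1) (measurable_queryLik (hζ k h) y).aestronglyMeasurable ?_
  filter_upwards [ae_jointLaw_mem_errorBox hX hε hbox k h] with z hz
  rw [Real.norm_of_nonneg (queryLik_nonneg _ y hz)]
  exact queryLik_le_one _ y hz

/-- The likelihoods of all responses to a batch sum to one at every parameter: this is the tower
property over one batch. -/
theorem sum_integral_queryLik_mul (hX : Measurable X) (hε : Measurable ε)
    (hζ : ∀ k h m, MeasurableSet (ζ k h m)) (hbox : ∀ᵐ ω ∂μ, ε ω ∈ errorBox M)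
    {k : ℕ} {h : History M k} {φ : Param d M → ℝ}
    (hφ : Integrable φ (jointLaw μ X ε Y k h)) :
    ∑ y, ∫ z, queryLik (ζ k h) y z * φ z ∂jointLaw μ X ε Y k h
      = ∫ z, φ z ∂jointLaw μ X ε Y k h := by
  rw [← integral_finsetSum _ fun y _ => integrable_queryLik_mul hX hε hζ hbox y hφ]
  congr 1 with z
  rw [← Finset.sum_mul]
  unfold queryLik
  rw [sum_channel, one_mul]

variable [IsProbabilityMeasure μ]

/-- Bayes' rule without the normalising constant. It follows by integrating the conditional
probability in `FollowsModel` over the events `(X*, ε*) ∈ B`, history `= h`. -/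
theorem jointLaw_snoc (hX : Measurable X) (hε : Measurable ε) (hY : ∀ k, Measurable (Y k))
    (hζ : ∀ k h m, MeasurableSet (ζ k h m)) (hmodel : FollowsModel μ X ε Y ζ)
    (k : ℕ) (h : History M k) (y : Response M) :
    jointLaw μ X ε Y (k + 1) (Fin.snoc h y : History M (k + 1))
      = (jointLaw μ X ε Y k h).withDensity
        fun z => ENNReal.ofReal (queryLik (ζ k h) y z) := by
  have hZ : Measurable fun ω => (X ω, ε ω) := hX.prodMk hε
  have hH := measurable_hist hY k
  have hm : MeasurableSpace.comap (fun ω => ((X ω, ε ω), hist Y k ω)) inferInstance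
      ≤ ‹MeasurableSpace Ω› := (hZ.prodMk hH).comap_le
  have hYy : MeasurableSet (Y k ⁻¹' {y}) := hY k (measurableSet_singleton y)
  have hHh : MeasurableSet (hist Y k ⁻¹' {h}) := hH (measurableSet_singleton h)
  have hind : Integrable ((Y k ⁻¹' {y}).indicator fun _ => (1 : ℝ)) μ :=
    (integrable_const _).indicator hYy
  have hc := hmodel k y
  have hcint := (integrable_congr hc).1 integrable_condExp
  have hcnn : 0 ≤ᵐ[μ] fun ω => channel (truth (ζ k (hist Y k ω)) (X ω)) y (ε ω) := by
    have h0 : 0 ≤ᵐ[μ] (Y k ⁻¹' {y}).indicator fun _ => (1 : ℝ) :=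
      ae_of_all _ fun ω => Set.indicator_nonneg (fun _ _ => zero_le_one) ω
    exact (condExp_nonneg h0).trans hc.le
  ext B hB
  have hZB : MeasurableSet ((fun ω => (X ω, ε ω)) ⁻¹' B) := hZ hB
  -- `S` belongs to the conditioning σ-algebra, so the conditional expectation may be integrated
  -- over it; on `S` the random query is the fixed batch `ζ k h`.
  set S : Set Ω := (fun ω => (X ω, ε ω)) ⁻¹' B ∩ hist Y k ⁻¹' {h} with hS
  have hSm : MeasurableSet[MeasurableSpace.comap (fun ω => ((X ω, ε ω), hist Y k ω))
      inferInstance] S := by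
    refine ⟨B ×ˢ {h}, hB.prod (measurableSet_singleton h), ?_⟩
    ext ω; simp [hS]
  have hset := setIntegral_condExp hm hind hSm
  rw [setIntegral_congr_ae (hm _ hSm) (hc.mono fun ω h _ => h), setIntegral_indicator hYy] at hset
  simp only [integral_const, smul_eq_mul, mul_one, measureReal_restrict_apply_univ] at hset
  rw [withDensity_apply _ hB]
  have hlik : Measurable fun z => ENNReal.ofReal (queryLik (ζ k h) y z) :=
    (measurable_queryLik (hζ k h) y).ennreal_ofReal
  unfold jointLaw
  rw [setLIntegral_map hB hlik hZ, Measure.restrict_restrict hZB, Measure.map_apply hZ hB,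
    Measure.restrict_apply hZB, ← hS]
  have hleft : (fun ω => (X ω, ε ω)) ⁻¹' B ∩ hist Y (k + 1) ⁻¹' {(Fin.snoc h y : History M (k + 1))}
      = S ∩ Y k ⁻¹' {y} := by
    ext ω
    simp only [Set.mem_inter_iff, Set.mem_preimage, Set.mem_singleton_iff, hS,
      hist_succ_eq_snoc_iff, and_assoc]
  have hright : ∫⁻ ω in S, ENNReal.ofReal (queryLik (ζ k h) y (X ω, ε ω)) ∂μ
      = ∫⁻ ω in S, ENNReal.ofReal (channel (truth (ζ k (hist Y k ω)) (X ω)) y (ε ω)) ∂μ := by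
    refine setLIntegral_congr_fun (hm _ hSm) fun ω hω => ?_
    have : hist Y k ω = h := hω.2
    simp only [this, queryLik]
  rw [hleft, hright, ← ofReal_integral_eq_lintegral_ofReal hcint.integrableOn
    (ae_restrict_of_ae hcnn), hset, ofReal_measureReal]

/-! ### The likelihood of a history and the chain rule. -/

/-- The likelihood of the history `h` under the policy `ζ`. -/
noncomputable def likelihood (ζ : Policy d M) : ∀ k, History M k → Param d M → ℝ
  | 0, _, _ => 1
  | k + 1, w, z => likelihood ζ k (fun j => w j.castSucc) z *
      queryLik (ζ k fun j => w j.castSucc) (w (Fin.last k)) z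

theorem likelihood_snoc (k : ℕ) (h : History M k) (y : Response M) (z : Param d M) :
    likelihood ζ (k + 1) (Fin.snoc h y : History M (k + 1)) z
      = likelihood ζ k h z * queryLik (ζ k h) y z := by
  simp [likelihood]

theorem exists_eq_snoc {k : ℕ} (w : History M (k + 1)) :
    ∃ (h : History M k) (y : Response M), w = (Fin.snoc h y : History M (k + 1)) :=
  ⟨Fin.init w, w (Fin.last k), (Fin.snoc_init_self w).symm⟩

theorem measurable_likelihood (hζ : ∀ k h m, MeasurableSet (ζ k h m)) (k : ℕ) (h : History M k) :
    Measurable (likelihood ζ k h) := by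
  induction k with
  | zero => exact measurable_const
  | succ k ih =>
    obtain ⟨h, y, rfl⟩ := exists_eq_snoc h
    simp_rw [funext (likelihood_snoc k h y)]
    exact (ih h).mul (measurable_queryLik (hζ k h) y)

/-- Each new response reweights the law by its own likelihood, so the points where that factor
vanishes lose their mass. This is what allows logarithms of products to be split. -/
theorem ae_likelihood_pos (hX : Measurable X) (hε : Measurable ε) (hY : ∀ k, Measurable (Y k))
    (hζ : ∀ k h m, MeasurableSet (ζ k h m)) (hmodel : FollowsModel μ X ε Y ζ)
    (k : ℕ) (h : History M k) : ∀ᵐ z ∂jointLaw μ X ε Y k h, 0 < likelihood ζ k h z := by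
  induction k with
  | zero => exact ae_of_all _ fun z => zero_lt_one
  | succ k ih =>
    obtain ⟨h, y, rfl⟩ := exists_eq_snoc h
    rw [jointLaw_snoc hX hε hY hζ hmodel]
    have h1 := withDensity_absolutelyContinuous (jointLaw μ X ε Y k h)
      (fun z => ENNReal.ofReal (queryLik (ζ k h) y z)) |>.ae_le (ih h)
    have h2 : ∀ᵐ z ∂(jointLaw μ X ε Y k h).withDensity
        (fun z => ENNReal.ofReal (queryLik (ζ k h) y z)), 0 < queryLik (ζ k h) y z := by
      rw [ae_withDensity_iff (measurable_queryLik (hζ k h) y).ennreal_ofReal]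
      exact ae_of_all _ fun z hz => by simpa using hz
    filter_upwards [h1, h2] with z hz1 hz2
    rw [likelihood_snoc]
    exact mul_pos hz1 hz2

theorem integral_jointLaw_snoc (hX : Measurable X) (hε : Measurable ε)
    (hY : ∀ k, Measurable (Y k)) (hζ : ∀ k h m, MeasurableSet (ζ k h m))
    (hmodel : FollowsModel μ X ε Y ζ) (hbox : ∀ᵐ ω ∂μ, ε ω ∈ errorBox M)
    (k : ℕ) (h : History M k) (y : Response M) (φ : Param d M → ℝ) :
    ∫ z, φ z ∂jointLaw μ X ε Y (k + 1) (Fin.snoc h y : History M (k + 1))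
      = ∫ z, queryLik (ζ k h) y z * φ z ∂jointLaw μ X ε Y k h := by
  rw [jointLaw_snoc hX hε hY hζ hmodel, integral_withDensity_eq_integral_toReal_smul
    (measurable_queryLik (hζ k h) y).ennreal_ofReal (ae_of_all _ fun _ => ENNReal.ofReal_lt_top)]
  refine integral_congr_ae ?_
  filter_upwards [ae_jointLaw_mem_errorBox hX hε hbox k h] with z hz
  rw [ENNReal.toReal_ofReal (queryLik_nonneg _ y hz), smul_eq_mul]

theorem integrable_jointLaw_snoc_iff (hX : Measurable X) (hε : Measurable ε)
    (hY : ∀ k, Measurable (Y k)) (hζ : ∀ k h m, MeasurableSet (ζ k h m))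
    (hmodel : FollowsModel μ X ε Y ζ) (hbox : ∀ᵐ ω ∂μ, ε ω ∈ errorBox M)
    (k : ℕ) (h : History M k) (y : Response M) (φ : Param d M → ℝ) :
    Integrable φ (jointLaw μ X ε Y (k + 1) (Fin.snoc h y : History M (k + 1)))
      ↔ Integrable (fun z => queryLik (ζ k h) y z * φ z) (jointLaw μ X ε Y k h) := by
  rw [jointLaw_snoc hX hε hY hζ hmodel, integrable_withDensity_iff_integrable_smul'
    (measurable_queryLik (hζ k h) y).ennreal_ofReal (ae_of_all _ fun _ => ENNReal.ofReal_lt_top)]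
  refine integrable_congr ?_
  filter_upwards [ae_jointLaw_mem_errorBox hX hε hbox k h] with z hz
  rw [ENNReal.toReal_ofReal (queryLik_nonneg _ y hz), smul_eq_mul]

/-- With `q` the new factor and `L` the old likelihood this is `q log (L q) = q log L + q log q`;
the weight `q` makes it hold at `q = 0` too. -/
theorem queryLik_mul_log_likelihood_snoc {k : ℕ} {h : History M k} {y : Response M}
    {z : Param d M} (hz : 0 < likelihood ζ k h z) :
    queryLik (ζ k h) y z * Real.log (likelihood ζ (k + 1) (Fin.snoc h y : History M (k + 1)) z)
      = queryLik (ζ k h) y z * Real.log (likelihood ζ k h z)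
        - Real.negMulLog (queryLik (ζ k h) y z) := by
  rw [likelihood_snoc]
  rcases eq_or_ne (queryLik (ζ k h) y z) 0 with h0 | h0
  · simp [h0]
  · rw [Real.log_mul hz.ne' h0, Real.negMulLog]
    ring

theorem integrable_log_likelihood (hX : Measurable X) (hε : Measurable ε)
    (hY : ∀ k, Measurable (Y k)) (hζ : ∀ k h m, MeasurableSet (ζ k h m))
    (hmodel : FollowsModel μ X ε Y ζ) (hbox : ∀ᵐ ω ∂μ, ε ω ∈ errorBox M)
    (k : ℕ) (h : History M k) :
    Integrable (fun z => Real.log (likelihood ζ k h z)) (jointLaw μ X ε Y k h) := by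
  induction k with
  | zero => simp [likelihood]
  | succ k ih =>
    obtain ⟨h, y, rfl⟩ := exists_eq_snoc h
    rw [integrable_jointLaw_snoc_iff hX hε hY hζ hmodel hbox]
    refine ((integrable_queryLik_mul hX hε hζ hbox y (ih h)).sub (integrable_negMulLog_queryLik
      (ae_jointLaw_mem_errorBox hX hε hbox k h) (hζ k h) y)).congr ?_
    filter_upwards [ae_likelihood_pos hX hε hY hζ hmodel k h] with z hz
    exact (queryLik_mul_log_likelihood_snoc hz).symm

theorem integral_queryLik_jointLaw (hX : Measurable X) (hε : Measurable ε)
    (hY : ∀ k, Measurable (Y k)) (hζ : ∀ k h m, MeasurableSet (ζ k h m))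
    (hmodel : FollowsModel μ X ε Y ζ) (hbox : ∀ᵐ ω ∂μ, ε ω ∈ errorBox M)
    (k : ℕ) (h : History M k) (y : Response M) :
    ∫ z, queryLik (ζ k h) y z ∂jointLaw μ X ε Y k h
      = μ.real (hist Y (k + 1) ⁻¹' {(Fin.snoc h y : History M (k + 1))}) := by
  rw [← jointLaw_real_univ hX hε]
  have := integral_jointLaw_snoc hX hε hY hζ hmodel hbox k h y fun _ => (1 : ℝ)
  simpa using this.symm

/-- Chain rule along one batch: the expected gain is the increase of the entropy of the history
plus the increase of the expected log-likelihood. -/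
theorem mul_gain_posterior (hX : Measurable X) (hε : Measurable ε)
    (hY : ∀ k, Measurable (Y k)) (hζ : ∀ k h m, MeasurableSet (ζ k h m))
    (hmodel : FollowsModel μ X ε Y ζ) (hbox : ∀ᵐ ω ∂μ, ε ω ∈ errorBox M)
    (k : ℕ) (h : History M k) :
    μ.real (hist Y k ⁻¹' {h}) * gain (posterior μ X ε Y k h) (ζ k h)
      = ∑ y, Real.negMulLog (μ.real (hist Y (k + 1) ⁻¹' {(Fin.snoc h y : History M (k + 1))}))
        - Real.negMulLog (μ.real (hist Y k ⁻¹' {h}))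
        + ∑ y, ∫ z, Real.log (likelihood ζ (k + 1) (Fin.snoc h y : History M (k + 1)) z)
            ∂jointLaw μ X ε Y (k + 1) (Fin.snoc h y : History M (k + 1))
        - ∫ z, Real.log (likelihood ζ k h z) ∂jointLaw μ X ε Y k h := by
  have hbox' := ae_jointLaw_mem_errorBox (Y := Y) hX hε hbox k h
  have hlog := integrable_log_likelihood hX hε hY hζ hmodel hbox k h
  set ν := jointLaw μ X ε Y k h with hν
  set m := μ.real (hist Y k ⁻¹' {h}) with hm
  have hstep : ∑ y, ∫ z, Real.log (likelihood ζ (k + 1) (Fin.snoc h y : History M (k + 1)) z)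
        ∂jointLaw μ X ε Y (k + 1) (Fin.snoc h y : History M (k + 1))
      = ∫ z, Real.log (likelihood ζ k h z) ∂ν
        - ∑ y, ∫ z, Real.negMulLog (queryLik (ζ k h) y z) ∂ν := by
    rw [← sum_integral_queryLik_mul hX hε hζ hbox hlog, ← Finset.sum_sub_distrib]
    refine Finset.sum_congr rfl fun y _ => ?_
    rw [integral_jointLaw_snoc hX hε hY hζ hmodel hbox,
      ← integral_sub (integrable_queryLik_mul hX hε hζ hbox y hlog)
        (integrable_negMulLog_queryLik hbox' (hζ k h) y)]
    refine integral_congr_ae ?_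
    filter_upwards [ae_likelihood_pos hX hε hY hζ hmodel k h] with z hz
    exact queryLik_mul_log_likelihood_snoc hz
  have hmass : ∑ y, μ.real (hist Y (k + 1) ⁻¹' {(Fin.snoc h y : History M (k + 1))}) = m := by
    have := sum_integral_queryLik_mul (Y := Y) hX hε hζ hbox
      (integrable_const (1 : ℝ) : Integrable _ (jointLaw μ X ε Y k h))
    simp only [mul_one, integral_queryLik_jointLaw hX hε hY hζ hmodel hbox, integral_const,
      smul_eq_mul, jointLaw_real_univ hX hε] at this
    exact this
  rw [hstep]
  -- A null history contributes zero to every term, whatever its posterior is; otherwise the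
  -- posterior is `ν` divided by `m`.
  rcases (measureReal_nonneg : 0 ≤ m).eq_or_lt with h0 | h0
  · have hν0 : ν = 0 := by
      rw [← Measure.measure_univ_eq_zero, ← measureReal_eq_zero_iff, hν,
        jointLaw_real_univ hX hε, ← hm, h0]
    have hm0 : ∀ y, μ.real (hist Y (k + 1) ⁻¹' {(Fin.snoc h y : History M (k + 1))}) = 0 := by
      intro y
      rw [← integral_queryLik_jointLaw hX hε hY hζ hmodel hbox, ← hν, hν0, integral_zero_measure]
    have hm0' : m = 0 := h0.symm
    simp [hm0', hm0, hν0]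
  · have hP : posterior μ X ε Y k h = (μ (hist Y k ⁻¹' {h}))⁻¹ • ν := posterior_eq k h
    have hfin : IsFiniteMeasure (posterior μ X ε Y k h) := by
      unfold posterior; infer_instance
    have hPbox : ∀ᵐ z ∂posterior μ X ε Y k h, z.2 ∈ errorBox M := by
      rw [hP]; exact Measure.ae_smul_measure hbox' _
    have hint : ∀ φ : Param d M → ℝ, ∫ z, φ z ∂posterior μ X ε Y k h = m⁻¹ * ∫ z, φ z ∂ν := by
      intro φ
      rw [hP, integral_smul_measure, ENNReal.toReal_inv, smul_eq_mul]; rfl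
    -- Undoes the normalisation of the posterior. Summed over responses, whose masses add up to `m`,
    -- the correction `q * log m` becomes `m * log m`, the entropy term of the old history.
    have hent : ∀ q : ℝ, m * Real.negMulLog (m⁻¹ * q) = Real.negMulLog q + q * Real.log m := by
      intro q
      have h0' : m ≠ 0 := h0.ne'
      rw [Real.negMulLog_mul, Real.negMulLog, Real.log_inv]
      field_simp
      ring
    rw [gain_eq hPbox (hζ k h)]
    simp only [hint, hν, integral_queryLik_jointLaw hX hε hY hζ hmodel hbox]
    rw [← Finset.mul_sum, mul_sub, ← mul_assoc, mul_inv_cancel₀ h0.ne', one_mul, Finset.mul_sum]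
    simp only [hent]
    rw [Finset.sum_add_distrib, ← Finset.sum_mul, hmass, Real.negMulLog]
    ring

end Posterior

/-! ### Summation over histories and the entropy inequality. -/

section EntropyBound

variable {Ω : Type*} [MeasurableSpace Ω] {d M : ℕ} {μ : Measure Ω}
  {X : Ω → EuclideanSpace ℝ (Fin d)} {ε : Ω → EuclideanSpace ℝ (Fin M)}
  {Y : ℕ → Ω → Response M} {ζ : Policy d M} {p₀ : Param d M → ℝ}

theorem integrable_jointLaw (hX : Measurable X) (hε : Measurable ε) (hY : ∀ k, Measurable (Y k))
    {k : ℕ} {φ : History M k → Param d M → ℝ} (hφ : ∀ h, Measurable (φ h))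
    (hint : Integrable (fun ω => φ (hist Y k ω) (X ω, ε ω)) μ) (h : History M k) :
    Integrable (φ h) (jointLaw μ X ε Y k h) := by
  unfold jointLaw
  rw [integrable_map_measure (hφ h).aestronglyMeasurable (hX.prodMk hε).aemeasurable]
  refine (integrableOn_congr_fun (fun ω hω => ?_)
    (measurable_hist hY k (measurableSet_singleton h))).1 hint.integrableOn
  have : hist Y k ω = h := hω
  simp [this]

theorem sum_integral_jointLaw (hX : Measurable X) (hε : Measurable ε)
    (hY : ∀ k, Measurable (Y k)) {k : ℕ} {φ : History M k → Param d M → ℝ}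
    (hφ : ∀ h, Measurable (φ h))
    (hint : Integrable (fun ω => φ (hist Y k ω) (X ω, ε ω)) μ) :
    ∑ h, ∫ z, φ h z ∂jointLaw μ X ε Y k h = ∫ ω, φ (hist Y k ω) (X ω, ε ω) ∂μ := by
  have hm : ∀ h, MeasurableSet (hist Y k ⁻¹' {h}) := fun h =>
    measurable_hist hY k (measurableSet_singleton h)
  have huniv : ⋃ h, hist Y k ⁻¹' {h} = Set.univ := by
    ext ω; simp
  rw [← setIntegral_univ, ← huniv, integral_iUnion_fintype hm
    (fun a b hab => Disjoint.preimage _ (by simpa using hab)) fun h => hint.integrableOn]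
  refine Finset.sum_congr rfl fun h _ => ?_
  unfold jointLaw
  rw [integral_map (hX.prodMk hε).aemeasurable (hφ h).aestronglyMeasurable]
  refine setIntegral_congr_fun (hm h) fun ω hω => ?_
  have : hist Y k ω = h := hω
  simp [this]

theorem integral_comp_hist [IsProbabilityMeasure μ] (hY : ∀ k, Measurable (Y k)) (k : ℕ)
    (φ : History M k → ℝ) :
    ∫ ω, φ (hist Y k ω) ∂μ = ∑ h, μ.real (hist Y k ⁻¹' {h}) * φ h := by
  have hH := measurable_hist hY k
  rw [← integral_map hH.aemeasurable (f := φ) (measurable_of_finite φ).aestronglyMeasurable,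
    integral_fintype Integrable.of_finite]
  refine Finset.sum_congr rfl fun h _ => ?_
  rw [map_measureReal_apply hH (measurableSet_singleton h), smul_eq_mul]

theorem jointLaw_eq_withDensity [IsProbabilityMeasure μ] (hX : Measurable X) (hε : Measurable ε)
    (hY : ∀ k, Measurable (Y k)) (hζ : ∀ k h m, MeasurableSet (ζ k h m))
    (hmodel : FollowsModel μ X ε Y ζ) (hp₀_meas : Measurable p₀)
    (hp₀_box : ∀ z : Param d M, z.2 ∉ errorBox M → p₀ z = 0)
    (hprior : μ.map (fun ω => (X ω, ε ω)) = volume.withDensity fun z => ENNReal.ofReal (p₀ z))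
    (k : ℕ) (h : History M k) :
    jointLaw μ X ε Y k h
      = volume.withDensity fun z => ENNReal.ofReal (p₀ z * likelihood ζ k h z) := by
  induction k with
  | zero => simp [jointLaw_zero, hprior, likelihood]
  | succ k ih =>
    obtain ⟨h, y, rfl⟩ := exists_eq_snoc h
    have hf : Measurable fun z => p₀ z * likelihood ζ k h z :=
      hp₀_meas.mul (measurable_likelihood hζ k h)
    rw [jointLaw_snoc hX hε hY hζ hmodel, ih h, ← withDensity_mul _ hf.ennreal_ofReal
      (measurable_queryLik (hζ k h) y).ennreal_ofReal]
    congr 1 with z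
    rw [Pi.mul_apply, likelihood_snoc]
    -- Outside the box `queryLik` may be negative and `ofReal` need not be multiplicative, but the
    -- prior density vanishes there.
    by_cases hz : z.2 ∈ errorBox M
    · rw [← mul_assoc, ENNReal.ofReal_mul' (queryLik_nonneg _ y hz)]
    · simp [hp₀_box z hz]

/-- The total expected gain is the mutual information of the parameter and the history. -/
theorem sum_integral_gain [IsProbabilityMeasure μ] (hX : Measurable X) (hε : Measurable ε)
    (hY : ∀ k, Measurable (Y k)) (hζ : ∀ k h m, MeasurableSet (ζ k h m))
    (hmodel : FollowsModel μ X ε Y ζ) (hbox : ∀ᵐ ω ∂μ, ε ω ∈ errorBox M) (n : ℕ) :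
    ∑ k ∈ Finset.range n,
        ∫ ω, gain (posterior μ X ε Y k (hist Y k ω)) (ζ k (hist Y k ω)) ∂μ
      = ∑ h : History M n, Real.negMulLog (μ.real (hist Y n ⁻¹' {h}))
        + ∑ h, ∫ z, Real.log (likelihood ζ n h z) ∂jointLaw μ X ε Y n h := by
  induction n with
  | zero =>
    have : ∀ h : History M 0, hist Y 0 ⁻¹' {h} = Set.univ := fun h => by
      ext ω; simp [Subsingleton.elim (hist Y 0 ω) h]
    simp [likelihood, this]
  | succ n ih =>
    rw [Finset.sum_range_succ, ih, integral_comp_hist hY n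
      fun h => gain (posterior μ X ε Y n h) (ζ n h)]
    simp_rw [mul_gain_posterior hX hε hY hζ hmodel hbox, Finset.sum_sub_distrib,
      Finset.sum_add_distrib, Finset.sum_sub_distrib, ← sum_history_succ
        fun w => Real.negMulLog (μ.real (hist Y (n + 1) ⁻¹' {w})), ← sum_history_succ
        fun w => ∫ z, Real.log (likelihood ζ (n + 1) w z) ∂jointLaw μ X ε Y (n + 1) w]
    ring

theorem integral_gain_le_integral_optimalGain [IsProbabilityMeasure μ] (hX : Measurable X)
    (hε : Measurable ε) (hY : ∀ k, Measurable (Y k)) (hbox : ∀ᵐ ω ∂μ, ε ω ∈ errorBox M)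
    {𝒳 : Set (EuclideanSpace ℝ (Fin d))} {J : ℕ → Fin M → ℕ}
    (hζ : ∀ k h, Admissible 𝒳 (J k) (ζ k h)) (k : ℕ) :
    ∫ ω, gain (posterior μ X ε Y k (hist Y k ω)) (ζ k (hist Y k ω)) ∂μ
      ≤ ∫ ω, optimalGain 𝒳 (J k) (posterior μ X ε Y k (hist Y k ω)) ∂μ := by
  rw [integral_comp_hist hY k fun h => gain (posterior μ X ε Y k h) (ζ k h),
    integral_comp_hist hY k fun h => optimalGain 𝒳 (J k) (posterior μ X ε Y k h)]
  refine Finset.sum_le_sum fun h _ => mul_le_mul_of_nonneg_left ?_ measureReal_nonneg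
  have hfin : IsFiniteMeasure (posterior μ X ε Y k h) := by
    unfold posterior; infer_instance
  refine gain_le_optimalGain ?_ (hζ k h)
  rw [posterior_eq]
  exact Measure.ae_smul_measure (ae_jointLaw_mem_errorBox hX hε hbox k h) _

theorem ae_mem_errorBox (hX : Measurable X) (hε : Measurable ε) (hp₀_meas : Measurable p₀)
    (hp₀_box : ∀ z : Param d M, z.2 ∉ errorBox M → p₀ z = 0)
    (hprior : μ.map (fun ω => (X ω, ε ω)) = volume.withDensity fun z => ENNReal.ofReal (p₀ z)) :
    ∀ᵐ ω ∂μ, ε ω ∈ errorBox M := by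
  have : ∀ᵐ z ∂μ.map (fun ω => (X ω, ε ω)), z.2 ∈ errorBox M := by
    rw [hprior, ae_withDensity_iff hp₀_meas.ennreal_ofReal]
    refine ae_of_all _ fun z hz => ?_
    by_contra h
    simp [hp₀_box z h] at hz
  exact ae_of_ae_map (hX.prodMk hε).aemeasurable this

theorem integrable_log_prior (hX : Measurable X) (hε : Measurable ε) (hp₀_meas : Measurable p₀)
    (hp₀_nonneg : ∀ z, 0 ≤ p₀ z) (hp₀_entropy : Integrable fun z => Real.negMulLog (p₀ z))
    (hprior : μ.map (fun ω => (X ω, ε ω)) = volume.withDensity fun z => ENNReal.ofReal (p₀ z)) :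
    Integrable (fun ω => Real.log (p₀ (X ω, ε ω))) μ := by
  have h := integrable_map_measure (μ := μ) (f := fun ω => (X ω, ε ω))
    (g := fun z => Real.log (p₀ z)) (Real.measurable_log.comp hp₀_meas).aestronglyMeasurable
    (hX.prodMk hε).aemeasurable
  refine h.1 ?_
  rw [hprior, integrable_withDensity_iff_integrable_smul' hp₀_meas.ennreal_ofReal
    (ae_of_all _ fun _ => ENNReal.ofReal_lt_top)]
  refine hp₀_entropy.neg.congr (ae_of_all _ fun z => ?_)
  simp [ENNReal.toReal_ofReal (hp₀_nonneg z), Real.negMulLog]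

theorem integral_log_prior (hX : Measurable X) (hε : Measurable ε) (hp₀_meas : Measurable p₀)
    (hp₀_nonneg : ∀ z, 0 ≤ p₀ z)
    (hprior : μ.map (fun ω => (X ω, ε ω)) = volume.withDensity fun z => ENNReal.ofReal (p₀ z)) :
    ∫ ω, Real.log (p₀ (X ω, ε ω)) ∂μ = -diffEntropy p₀ := by
  rw [← integral_map (hX.prodMk hε).aemeasurable (f := fun z => Real.log (p₀ z))
    (Real.measurable_log.comp hp₀_meas).aestronglyMeasurable, hprior,
    integral_withDensity_eq_integral_toReal_smul hp₀_meas.ennreal_ofReal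
    (ae_of_all _ fun _ => ENNReal.ofReal_lt_top), diffEntropy, ← integral_neg]
  congr 1 with z
  simp [ENNReal.toReal_ofReal (hp₀_nonneg z), Real.negMulLog]

/-- Gibbs' inequality between the posterior density and a Gaussian density centred at an arbitrary
estimate of the target. -/
theorem diffEntropy_le [IsProbabilityMeasure μ] (hX : Measurable X) (hε : Measurable ε)
    (hY : ∀ k, Measurable (Y k)) (hζ : ∀ k h m, MeasurableSet (ζ k h m))
    (hmodel : FollowsModel μ X ε Y ζ) (hp₀_meas : Measurable p₀) (hp₀_nonneg : ∀ z, 0 ≤ p₀ z)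
    (hp₀_box : ∀ z : Param d M, z.2 ∉ errorBox M → p₀ z = 0)
    (hp₀_entropy : Integrable fun z => Real.negMulLog (p₀ z))
    (hprior : μ.map (fun ω => (X ω, ε ω)) = volume.withDensity fun z => ENNReal.ofReal (p₀ z))
    {n : ℕ} (a : History M n → EuclideanSpace ℝ (Fin d))
    (ha : Integrable (fun ω => ‖X ω - a (hist Y n ω)‖ ^ 2) μ) {s : ℝ} (hs : 0 < s) :
    diffEntropy p₀ ≤ ∑ k ∈ Finset.range n,
        ∫ ω, gain (posterior μ X ε Y k (hist Y k ω)) (ζ k (hist Y k ω)) ∂μ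
      + d / 2 * Real.log (2 * Real.pi * s) + (∫ ω, ‖X ω - a (hist Y n ω)‖ ^ 2 ∂μ) / (2 * s) := by
  have hbox := ae_mem_errorBox hX hε hp₀_meas hp₀_box hprior
  have hlogp := integrable_log_prior hX hε hp₀_meas hp₀_nonneg hp₀_entropy hprior
  have hlogp_meas : Measurable fun z => Real.log (p₀ z) := Real.measurable_log.comp hp₀_meas
  have hsq_meas : ∀ h, Measurable fun z : Param d M => ‖z.1 - a h‖ ^ 2 := fun h => by fun_prop
  set c : ℝ := d / 2 * Real.log (2 * Real.pi * s) with hc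
  -- Gibbs' inequality for one history; `c` is the log-normaliser of the Gaussian, and `m log m`
  -- appears as `-negMulLog m`.
  have hw : ∀ h, (∫ z, -(‖z.1 - a h‖ ^ 2 / (2 * s)) ∂jointLaw μ X ε Y n h)
        - μ.real (hist Y n ⁻¹' {h}) * c - Real.negMulLog (μ.real (hist Y n ⁻¹' {h}))
      ≤ ∫ z, Real.log (p₀ z) ∂jointLaw μ X ε Y n h
        + ∫ z, Real.log (likelihood ζ n h z) ∂jointLaw μ X ε Y n h := by
    intro h
    have hν := jointLaw_eq_withDensity hX hε hY hζ hmodel hp₀_meas hp₀_box hprior n h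
    have hνbox := ae_jointLaw_mem_errorBox (Y := Y) hX hε hbox n h
    have hlogp_h : Integrable (fun z => Real.log (p₀ z)) (jointLaw μ X ε Y n h) :=
      integrable_jointLaw hX hε hY (φ := fun _ z => Real.log (p₀ z)) (fun _ => hlogp_meas) hlogp h
    have hlik_h := integrable_log_likelihood hX hε hY hζ hmodel hbox n h
    have hsq_h : Integrable (fun z => -(‖z.1 - a h‖ ^ 2 / (2 * s))) (jointLaw μ X ε Y n h) :=
      ((integrable_jointLaw hX hε hY hsq_meas ha h).div_const _).neg
    have hf_meas : Measurable fun z => p₀ z * likelihood ζ n h z :=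
      hp₀_meas.mul (measurable_likelihood hζ n h)
    have hpos : ∀ᵐ z ∂jointLaw μ X ε Y n h, p₀ z * likelihood ζ n h z ≠ 0 := by
      rw [hν, ae_withDensity_iff hf_meas.ennreal_ofReal]
      refine ae_of_all _ fun z hz h0 => hz ?_
      rw [h0, ENNReal.ofReal_zero]
    have hlogf : (fun z => Real.log (p₀ z) + Real.log (likelihood ζ n h z))
        =ᵐ[jointLaw μ X ε Y n h] fun z => Real.log (p₀ z * likelihood ζ n h z) := by
      filter_upwards [hpos] with z hz
      exact (Real.log_mul (left_ne_zero_of_mul hz) (right_ne_zero_of_mul hz)).symm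
    have hlogq : (fun z => -(‖z.1 - a h‖ ^ 2 / (2 * s)) - c)
        =ᵐ[jointLaw μ X ε Y n h] fun z => Real.log (gaussianBox (a h) s z) := by
      filter_upwards [hνbox] with z hz
      rw [log_gaussianBox _ _ hz]
      ring
    have key := integral_log_add_mul_log_le_integral_log hf_meas
      (measurable_gaussianBox (a h) s) hν (lintegral_gaussianBox_le_one (a h) hs)
      (hνbox.mono fun z hz => gaussianBox_pos (a h) s hz)
      ((hlogp_h.add hlik_h).congr hlogf) ((hsq_h.sub (integrable_const c)).congr hlogq)
    rw [← integral_congr_ae hlogf, ← integral_congr_ae hlogq, integral_add hlogp_h hlik_h,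
      integral_sub hsq_h (integrable_const c), integral_const, smul_eq_mul,
      jointLaw_real_univ hX hε] at key
    rw [Real.negMulLog]
    linarith
  -- The integrals against the laws `jointLaw` add up to expectations under `μ`, and the masses
  -- multiplying `c` add up to one.
  have hsum := Finset.sum_le_sum fun h (_ : h ∈ Finset.univ) => hw h
  have hone : ∑ h, μ.real (hist Y n ⁻¹' {h}) = 1 := by
    have := integral_comp_hist (μ := μ) hY n fun _ => (1 : ℝ)
    simpa using this.symm
  simp_rw [Finset.sum_sub_distrib, Finset.sum_add_distrib, ← Finset.sum_mul, hone, integral_neg,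
    integral_div, Finset.sum_neg_distrib, ← Finset.sum_div] at hsum
  rw [sum_integral_jointLaw hX hε hY hsq_meas ha,
    sum_integral_jointLaw hX hε hY (φ := fun _ z => Real.log (p₀ z)) (fun _ => hlogp_meas) hlogp,
    integral_log_prior hX hε hp₀_meas hp₀_nonneg hprior] at hsum
  rw [sum_integral_gain hX hε hY hζ hmodel hbox]
  linarith

end EntropyBound

end TwentyQuestions

/-! ### From the entropy inequality to the mean-square error. -/

/-- Lower bound on the joint mean-square error with unknown error probabilities. The mean-square
errors are taken in `[0, ∞]`, so no moment of the prior is assumed. The policy is any admissible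
one, in particular an optimal one. -/
theorem theorem8 {Ω : Type*} [MeasurableSpace Ω] (μ : Measure Ω) [IsProbabilityMeasure μ]
    {d M : ℕ} (𝒳 : Set (EuclideanSpace ℝ (Fin d)))
    -- the prior density of `(X*, ε*)`, on `𝒳 × [0, 1/2)^M`, with finite entropy
    (p₀ : Param d M → ℝ) (hp₀_meas : Measurable p₀) (hp₀_nonneg : ∀ z, 0 ≤ p₀ z)
    (hp₀_supp : ∀ z, ¬ (z.1 ∈ 𝒳 ∧ ∀ m, z.2 m ∈ Set.Ico (0 : ℝ) (1 / 2)) → p₀ z = 0)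
    (hp₀_entropy : Integrable (fun z => Real.negMulLog (p₀ z)))
    -- the target, the error probabilities and the responses
    (X : Ω → EuclideanSpace ℝ (Fin d)) (hX : Measurable X)
    (ε : Ω → EuclideanSpace ℝ (Fin M)) (hε : Measurable ε)
    (Y : ℕ → Ω → Response M) (hY : ∀ k, Measurable (Y k))
    (hprior : μ.map (fun ω => (X ω, ε ω)) = volume.withDensity (fun z => ENNReal.ofReal (p₀ z)))
    -- the policy, with query regions that are unions of at most `J k m` rectangles in `𝒳`
    (J : ℕ → Fin M → ℕ) (ζ : Policy d M) (hζ : ∀ k h, Admissible 𝒳 (J k) (ζ k h))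
    (hmodel : FollowsModel μ X ε Y ζ) (n : ℕ) :
    ENNReal.ofReal
        (Real.exp (2 * diffEntropy p₀ / d) / (2 * Real.pi * Real.exp 1) * d *
          Real.exp (-(2 * n * averageGain μ X ε Y 𝒳 J n) / d))
      ≤ ∫⁻ ω, ‖(μ[X | info Y n]) ω - X ω‖ₑ ^ 2 ∂μ
        + ∫⁻ ω, ‖(μ[ε | info Y n]) ω - ε ω‖ₑ ^ 2 ∂μ := by
  -- The location error alone satisfies the bound, so the error of `ε` is dropped.
  refine le_trans ?_ le_self_add
  rcases Nat.eq_zero_or_pos d with rfl | hd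
  · simp
  have hd' : (0 : ℝ) < d := by exact_mod_cast hd
  -- Being measurable for the history, the estimate is a function `a` of it; this holds also when
  -- `X` is not integrable and the conditional expectation is `0` by convention.
  obtain ⟨a, -, ha⟩ := (stronglyMeasurable_condExp :
    StronglyMeasurable[info Y n] (μ[X | info Y n])).exists_eq_measurable_comp
  have hrhs : ∫⁻ ω, ‖(μ[X | info Y n]) ω - X ω‖ₑ ^ 2 ∂μ
      = ∫⁻ ω, ENNReal.ofReal (‖X ω - a (hist Y n ω)‖ ^ 2) ∂μ := by
    refine lintegral_congr fun ω => ?_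
    rw [ha, Function.comp_apply, ← ofReal_norm, norm_sub_rev,
      ENNReal.ofReal_pow (norm_nonneg _)]
  rw [hrhs]
  have hsq_meas : Measurable fun ω => ‖X ω - a (hist Y n ω)‖ ^ 2 :=
    ((hX.sub ((measurable_of_finite a).comp (measurable_hist hY n))).norm).pow_const 2
  by_cases hint : Integrable (fun ω => ‖X ω - a (hist Y n ω)‖ ^ 2) μ
  swap
  · have htop : ∫⁻ ω, ENNReal.ofReal (‖X ω - a (hist Y n ω)‖ ^ 2) ∂μ = ⊤ := by
      by_contra h
      refine hint ⟨hsq_meas.aestronglyMeasurable, ?_⟩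
      rw [hasFiniteIntegral_iff_ofReal (ae_of_all _ fun ω => sq_nonneg _)]
      exact lt_top_iff_ne_top.2 h
    rw [htop]
    exact le_top
  rw [← ofReal_integral_eq_lintegral_ofReal hint (ae_of_all _ fun ω => sq_nonneg _)]
  refine ENNReal.ofReal_le_ofReal ?_
  set D := ∫ ω, ‖X ω - a (hist Y n ω)‖ ^ 2 ∂μ
  set G := n * averageGain μ X ε Y 𝒳 J n with hG
  have hp₀_box : ∀ z : Param d M, z.2 ∉ errorBox M → p₀ z = 0 :=
    fun z hz => hp₀_supp z fun h => hz h.2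
  have hbox := ae_mem_errorBox hX hε hp₀_meas hp₀_box hprior
  have hgain : ∑ k ∈ Finset.range n,
      ∫ ω, gain (posterior μ X ε Y k (hist Y k ω)) (ζ k (hist Y k ω)) ∂μ ≤ G := by
    have : G = ∑ k ∈ Finset.range n,
        ∫ ω, optimalGain 𝒳 (J k) (posterior μ X ε Y k (hist Y k ω)) ∂μ := by
      rw [hG, averageGain]
      -- For `n = 0` the average contains `1 / 0 = 0`, and both sides vanish.
      rcases Nat.eq_zero_or_pos n with rfl | hn
      · simp
      · have : (n : ℝ) ≠ 0 := by positivity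
        field_simp
    rw [this]
    exact Finset.sum_le_sum fun k _ =>
      integral_gain_le_integral_optimalGain hX hε hY hbox hζ k
  -- Chosen so that `d * s` is the target bound and `(d/2) log(2πs) = H(p₀) - G - d/2`; the entropy
  -- inequality then reduces to `d/2 ≤ D/(2s)`. Optimising over `s` would give `s = D/d`, which
  -- would require treating `D = 0` apart.
  set s : ℝ := Real.exp (2 * (diffEntropy p₀ - G) / d) / (2 * Real.pi * Real.exp 1) with hs
  have hs_pos : 0 < s := by positivity
  have hlog : d / 2 * Real.log (2 * Real.pi * s) = diffEntropy p₀ - G - d / 2 := by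
    have : 2 * Real.pi * s = Real.exp (2 * (diffEntropy p₀ - G) / d - 1) := by
      rw [hs, Real.exp_sub]
      field_simp
    rw [this, Real.log_exp]
    field_simp
  have hmain := diffEntropy_le hX hε hY (fun k h => (hζ k h).measurableSet) hmodel hp₀_meas
    hp₀_nonneg hp₀_box hp₀_entropy hprior a hint hs_pos
  rw [hlog] at hmain
  have hD : d / 2 ≤ D / (2 * s) := by linarith
  rw [le_div_iff₀ (by positivity)] at hD
  have hexp : Real.exp (2 * diffEntropy p₀ / d) / (2 * Real.pi * Real.exp 1) * d *
      Real.exp (-(2 * n * averageGain μ X ε Y 𝒳 J n) / d) = d * s := by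
    have : 2 * (diffEntropy p₀ - G) / d = 2 * diffEntropy p₀ / d
        + -(2 * n * averageGain μ X ε Y 𝒳 J n) / d := by
      rw [hG]; ring
    rw [hs, this, Real.exp_add]
    ring
  rw [hexp]
  linarith
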